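/- Let $\Gamma$ be a finite, simple, connected, undirected graph with $N$ vertices and nonzero real edge weights $\gamma_{ij}=\gamma_{ji}$ of either sign ($\gamma_{ij}=0$ if there is no edge $ij$). For a weighted graph $G$ with weights $g_{ij}$, let $\mathcal L(G)$ be the signed Laplacian with entries $\mathcal L(G)_{ij}=g_{ij}$ for $i\ne j$ and $\mathcal L(G)_{ii}=-\sum_{k\ne i}g_{ik}$, and let $\lambda_1(\mathcal L(G))\ge\lambda_2(\mathcal L(G))\ge\cdots$ be its eigenvalues, listed in decreasing order with multiplicity. Let $\Gamma_-$ be the graph on all $N$ vertices of $\Gamma$ with only the edges of negative weight (and their weights), let $c=c(\Gamma_-)$ be its number of connected components $\Gamma_{-,1},\dots,\Gamma_{-,c}$, and for real $t$ let $\Gamma(t)$ be the weighted graph obtained from $\Gamma$ by multiplying every negative weight by $t$ and keeping the positive weights. Let $\Gamma_{\cdot-}$ be the graph obtained from $\Gamma$ by contracting all negative edges: its vertices are the components of $\Gamma_-$, and for $a\neq b$ the weight between $\Gamma_{-,a}$ and $\Gamma_{-,b}$ is $\sum_{i\in\Gamma_{-,a},\,j\in\Gamma_{-,b}}\gamma_{ij}$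 (loops are dropped). Let $S$ be the $c\times c$ diagonal matrix with $S_{aa}=|V(\Gamma_{-,a})|$, and let $\tilde\lambda_1\ge\cdots\ge\tilde\lambda_c$ be the solutions $\lambda$, listed with multiplicity, of the generalized eigenvalue problem $\mathcal L(\Gamma_{\cdot-})v=\lambda Sv$. Then, for all sufficiently large $t>0$, the matrix $\mathcal L(\Gamma(t))$ has, counted with multiplicity, exactly $N-c$ positive eigenvalues, exactly $c-1$ negative eigenvalues and exactly one zero eigenvalue. Moreover, as $t\to+\infty$, $$\lambda_i(\mathcal L(\Gamma(t)))=t\,\lambda_i(\mathcal L(\Gamma_-))+O(1)\qquad (1\le i\le N-c),$$ $$\lambda_{N-c+j}(\mathcal L(\Gamma(t)))=\tilde\lambda_j+o(1)\qquad (1\le j\le c).$$ In particular $\tilde\lambda_1=0$ corresponds to the zero eigenvalue $\lambda_{N-c+1}(\mathcal L(\Gamma(t)))$, and the $c-1$ negative eigenvalues converge to $\tilde\lambda_2,\dots,\tilde\lambda_c$. -/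

import Mathlib

open Filter Topology Asymptotics

/-- A simple undirected edge-weighted graph with vertex set `V`: `i` and `j` are joined by an edge
exactly when `weight i j ≠ 0`, and the weights may have either sign. -/
structure WeightedGraph (V : Type*) where
  weight : V → V → ℝ
  symm : ∀ i j, weight i j = weight j i
  loopless : ∀ i, weight i i = 0

namespace WeightedGraph

variable {V : Type*}

/-- The underlying simple graph. -/
def graph (Γ : WeightedGraph V) : SimpleGraph V where
  Adj i j := Γ.weight i j ≠ 0
  symm := ⟨fun i j h => by rwa [Γ.symm j i]⟩
  loopless := ⟨fun i h => h (Γ.loopless i)⟩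

/-- The subgraph `Γ₋` on the same vertices, with the edges of negative weight and their weights. -/
noncomputable def negPart (Γ : WeightedGraph V) : WeightedGraph V where
  weight i j := min (Γ.weight i j) 0
  symm i j := by rw [Γ.symm i j]
  loopless i := by simp [Γ.loopless i]

/-- The graph `Γ(t) = Γ₊ + t Γ₋`: positive weights are kept, negative weights are multiplied
by `t`. -/
noncomputable def scaleNeg (Γ : WeightedGraph V) (t : ℝ) : WeightedGraph V where
  weight i j := if Γ.weight i j < 0 then t * Γ.weight i j else Γ.weight i j
  symm i j := by rw [Γ.symm i j]
  loopless i := by simp [Γ.loopless i]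

/-- The signed Laplacian: `γ i j` off the diagonal and `-∑_{k ≠ i} γ i k` on the diagonal. -/
def laplacian [Fintype V] [DecidableEq V] (Γ : WeightedGraph V) : Matrix V V ℝ :=
  Matrix.of fun i j => if i = j then -∑ k ∈ Finset.univ.erase i, Γ.weight i k else Γ.weight i j

theorem laplacian_isHermitian [Fintype V] [DecidableEq V] (Γ : WeightedGraph V) :
    Γ.laplacian.IsHermitian := by
  ext i j
  by_cases h : i = j
  · subst h; simp
  · simp [laplacian, h, Ne.symm h, Γ.symm i j]

/-- The eigenvalues of the signed Laplacian, with multiplicity, in decreasing order (indexed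
from `0`). -/
noncomputable def eigenvalue [Fintype V] [DecidableEq V] (Γ : WeightedGraph V) :
    Fin (Fintype.card V) → ℝ :=
  Γ.laplacian_isHermitian.eigenvalues₀

/-- The number of positive eigenvalues of the signed Laplacian, with multiplicity. -/
noncomputable def nPos [Fintype V] [DecidableEq V] (Γ : WeightedGraph V) : ℕ :=
  Nat.card {i // 0 < Γ.eigenvalue i}

/-- The number of zero eigenvalues of the signed Laplacian, with multiplicity. -/
noncomputable def nZero [Fintype V] [DecidableEq V] (Γ : WeightedGraph V) : ℕ :=
  Nat.card {i // Γ.eigenvalue i = 0}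

/-- The number of negative eigenvalues of the signed Laplacian, with multiplicity. -/
noncomputable def nNeg [Fintype V] [DecidableEq V] (Γ : WeightedGraph V) : ℕ :=
  Nat.card {i // Γ.eigenvalue i < 0}

/-- The type of connected components of `Γ₋`. -/
def NegComponent (Γ : WeightedGraph V) : Type _ := Γ.negPart.graph.ConnectedComponent

/-- The component of `Γ₋` that contains a given vertex. -/
noncomputable def negComponent (Γ : WeightedGraph V) (i : V) : Γ.NegComponent :=
  Γ.negPart.graph.connectedComponentMk i

noncomputable instance [Finite V] (Γ : WeightedGraph V) : Fintype Γ.NegComponent :=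
  haveI : Finite Γ.NegComponent := Quot.finite _
  Fintype.ofFinite _

noncomputable instance (Γ : WeightedGraph V) : DecidableEq Γ.NegComponent := Classical.decEq _

/-- The graph obtained from `Γ` by contracting all negative edges. Its vertices are the components
of `Γ₋`; parallel edges are merged into one edge carrying their total weight, and loops, which do
not contribute to the Laplacian, are dropped. -/
noncomputable def contractNeg [Fintype V] (Γ : WeightedGraph V) :
    WeightedGraph Γ.NegComponent where
  weight a b := if a = b then 0 else
    ∑ i with Γ.negComponent i = a, ∑ j with Γ.negComponent j = b, Γ.weight i j
  symm a b := by
    rw [Finset.sum_comm]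
    simp only [Γ.symm, eq_comm (a := a) (b := b)]
  loopless a := by simp

/-- The contracted inner product: the diagonal matrix of the numbers of vertices of the components
of `Γ₋`. -/
noncomputable def sizeMatrix (Γ : WeightedGraph V) :
    Matrix Γ.NegComponent Γ.NegComponent ℝ :=
  Matrix.diagonal fun a => (Nat.card {i // Γ.negComponent i = a} : ℝ)

end WeightedGraph

/-- `μ` lists, in decreasing order and with multiplicity, the solutions `x` of the generalized
eigenvalue problem `A v = x S v`: there is a basis of eigenvectors `b j` with
`A (b j) = μ j S (b j)`. For invertible `S` such a list is unique if it exists. -/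
def IsGenEigenvalueList {ι : Type*} [Fintype ι] (A S : Matrix ι ι ℝ)
    (μ : Fin (Fintype.card ι) → ℝ) : Prop :=
  Antitone μ ∧ ∃ b : Module.Basis (Fin (Fintype.card ι)) ℝ (ι → ℝ),
    ∀ j, A.mulVec (b j) = μ j • S.mulVec (b j)

/-! Write `L(Γ(t)) = P + t B` with `P = L(Γ₊)`, realised as `scaleNeg 0`, and `B = L(Γ₋)`. With this
sign convention `B` is positive semidefinite, `P` is negative semidefinite, and `ker B` is the space
of functions constant on the components of `Γ₋`, of dimension `c`. Weyl's inequality gives the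
`O(1)` estimate.

The bottom `c` eigenvalues tend to those of the compression of `P` to `ker B`. They never exceed
them, because `t B` vanishes on `ker B` (`eigenvalues_le_eigenvalues_compression`); the reverse
bound up to `ε` holds because a large `t` penalises any component orthogonal to `ker B`
(`eventually_le_eigenvalues`). In the basis of component indicators this compression is the
generalized problem for the contracted graph.

For the signs: on `(ker B)ᗮ` the term `t B` dominates, giving `N - c` positive eigenvalues;
connectedness makes all but the top compressed eigenvalue negative, giving `c - 1` negative ones;
constants are in the kernel, so the remaining eigenvalue is zero. -/

/-! ### Rayleigh quotients, Courant-Fischer and Weyl bounds. -/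

namespace LinearMap.IsSymmetric

open Module

variable {E : Type*} [NormedAddCommGroup E] [InnerProductSpace ℝ E] [FiniteDimensional ℝ E]
  {T : E →ₗ[ℝ] E} {n : ℕ}

local notation "⟪" x ", " y "⟫" => inner ℝ x y

theorem inner_apply_self_eq_sum (hT : T.IsSymmetric) (hn : finrank ℝ E = n) (x : E) :
    ⟪T x, x⟫ = ∑ i, hT.eigenvalues hn i * ((hT.eigenvectorBasis hn).repr x i) ^ 2 := by
  rw [← (hT.eigenvectorBasis hn).sum_inner_mul_inner (T x) x]
  refine Finset.sum_congr rfl fun i _ => ?_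
  rw [← OrthonormalBasis.repr_apply_apply, real_inner_comm, ← OrthonormalBasis.repr_apply_apply,
    hT.eigenvectorBasis_apply_self_apply hn]
  simp only [RCLike.ofReal_real_eq_id, id_eq]
  ring

theorem inner_apply_self_le (hT : T.IsSymmetric) (hn : finrank ℝ E = n) {k : Fin n} {x : E}
    (hx : ∀ i < k, (hT.eigenvectorBasis hn).repr x i = 0) :
    ⟪T x, x⟫ ≤ hT.eigenvalues hn k * ‖x‖ ^ 2 := by
  rw [hT.inner_apply_self_eq_sum hn, ← (hT.eigenvectorBasis hn).repr.norm_map x,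
    EuclideanSpace.real_norm_sq_eq, Finset.mul_sum]
  refine Finset.sum_le_sum fun i _ => ?_
  rcases lt_or_ge i k with h | h
  · simp [hx i h]
  · exact mul_le_mul_of_nonneg_right (hT.eigenvalues_antitone hn h) (sq_nonneg _)

theorem le_inner_apply_self (hT : T.IsSymmetric) (hn : finrank ℝ E = n) {k : Fin n} {x : E}
    (hx : ∀ i, k < i → (hT.eigenvectorBasis hn).repr x i = 0) :
    hT.eigenvalues hn k * ‖x‖ ^ 2 ≤ ⟪T x, x⟫ := by
  rw [hT.inner_apply_self_eq_sum hn, ← (hT.eigenvectorBasis hn).repr.norm_map x,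
    EuclideanSpace.real_norm_sq_eq, Finset.mul_sum]
  refine Finset.sum_le_sum fun i _ => ?_
  rcases lt_or_ge k i with h | h
  · simp [hx i h]
  · exact mul_le_mul_of_nonneg_right (hT.eigenvalues_antitone hn h) (sq_nonneg _)

end LinearMap.IsSymmetric

namespace OrthonormalBasis

open Module

variable {E : Type*} [NormedAddCommGroup E] [InnerProductSpace ℝ E] {n : ℕ}

theorem repr_eq_zero_of_mem_span (b : OrthonormalBasis (Fin n) ℝ E) {s : Set (Fin n)} {x : E}
    (hx : x ∈ Submodule.span ℝ (b '' s)) {i : Fin n} (hi : i ∉ s) : b.repr x i = 0 := by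
  rw [OrthonormalBasis.repr_apply_apply]
  induction hx using Submodule.span_induction with
  | mem x h =>
    obtain ⟨j, hj, rfl⟩ := h
    exact b.orthonormal.2 fun h => hi (h ▸ hj)
  | zero => simp
  | add x y _ _ hx hy => simp [inner_add_right, hx, hy]
  | smul a x _ hx => simp [inner_smul_right, hx]

theorem finrank_span_image (b : OrthonormalBasis (Fin n) ℝ E) (s : Finset (Fin n)) :
    finrank ℝ (Submodule.span ℝ (b '' s)) = s.card := by
  have := (b.orthonormal.linearIndependent.comp ((↑) : s → Fin n) Subtype.val_injective)
  have h := finrank_span_eq_card this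
  have hs : Set.range (b ∘ ((↑) : s → Fin n)) = b '' s := by
    rw [Set.range_comp]; congr 1; exact Subtype.range_coe
  rw [← hs]
  simpa using h

end OrthonormalBasis

namespace Submodule

open Module

theorem exists_mem_mem_ne_zero {E : Type*} [AddCommGroup E] [Module ℝ E] [FiniteDimensional ℝ E]
    (U W : Submodule ℝ E) (h : finrank ℝ E < finrank ℝ U + finrank ℝ W) :
    ∃ x ∈ U, x ∈ W ∧ x ≠ 0 := by
  by_contra! hc
  refine h.not_ge (finrank_add_finrank_le_of_disjoint ?_)
  exact disjoint_def.2 hc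

end Submodule

namespace LinearMap.IsSymmetric

open Module

variable {E : Type*} [NormedAddCommGroup E] [InnerProductSpace ℝ E] [FiniteDimensional ℝ E]
  {T B P : E →ₗ[ℝ] E} {n : ℕ}

local notation "⟪" x ", " y "⟫" => inner ℝ x y

/-- One half of the Courant-Fischer principle. -/
theorem le_eigenvalues_of_forall_mem (hT : T.IsSymmetric) (hn : finrank ℝ E = n) {k : Fin n}
    {a : ℝ} (W : Submodule ℝ E) (hW : (k : ℕ) < finrank ℝ W)
    (h : ∀ x ∈ W, a * ‖x‖ ^ 2 ≤ ⟪T x, x⟫) : a ≤ hT.eigenvalues hn k := by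
  set b := hT.eigenvectorBasis hn
  -- The eigenvectors of index at least `k` span dimension `n - k`, so this span must meet `W`, of
  -- dimension above `k`.
  obtain ⟨x, hx, hxW, hx0⟩ := Submodule.exists_mem_mem_ne_zero
    (Submodule.span ℝ (b '' (Finset.Ici k : Finset (Fin n)))) W (by
      rw [b.finrank_span_image, Fin.card_Ici]; omega)
  have h1 := hT.inner_apply_self_le hn (k := k) (x := x) fun i hi =>
    b.repr_eq_zero_of_mem_span hx (by simpa using hi)
  exact le_of_mul_le_mul_right ((h x hxW).trans h1) (by positivity)

/-- The other half of the Courant-Fischer principle. -/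
theorem eigenvalues_le_of_forall_mem (hT : T.IsSymmetric) (hn : finrank ℝ E = n) {k : Fin n}
    {a : ℝ} (W : Submodule ℝ E) (hW : n ≤ k + finrank ℝ W)
    (h : ∀ x ∈ W, ⟪T x, x⟫ ≤ a * ‖x‖ ^ 2) : hT.eigenvalues hn k ≤ a := by
  set b := hT.eigenvectorBasis hn
  obtain ⟨x, hx, hxW, hx0⟩ := Submodule.exists_mem_mem_ne_zero
    (Submodule.span ℝ (b '' (Finset.Iic k : Finset (Fin n)))) W (by
      rw [b.finrank_span_image, Fin.card_Iic]; omega)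
  have h1 := hT.le_inner_apply_self hn (k := k) (x := x) fun i hi =>
    b.repr_eq_zero_of_mem_span hx (by simpa using hi)
  exact le_of_mul_le_mul_right (h1.trans (h x hxW)) (by positivity)

/-- Weyl's perturbation inequality for the operators `P + t B`. -/
theorem abs_eigenvalues_sub_le (hT : T.IsSymmetric) (hB : B.IsSymmetric) (hn : finrank ℝ E = n)
    {C t : ℝ} (ht : 0 ≤ t) (hTB : T = P + t • B) (hP : ∀ x, |⟪P x, x⟫| ≤ C * ‖x‖ ^ 2)
    (k : Fin n) : |hT.eigenvalues hn k - t * hB.eigenvalues hn k| ≤ C := by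
  set b := hB.eigenvectorBasis hn
  have key : ∀ x, ⟪T x, x⟫ = ⟪P x, x⟫ + t * ⟪B x, x⟫ := fun x => by
    simp [hTB, inner_add_left, real_inner_smul_left]
  rw [abs_le]
  constructor
  · suffices t * hB.eigenvalues hn k - C ≤ hT.eigenvalues hn k by linarith
    refine hT.le_eigenvalues_of_forall_mem hn
      (Submodule.span ℝ (b '' (Finset.Iic k : Finset (Fin n)))) ?_ fun x hx => ?_
    · rw [b.finrank_span_image, Fin.card_Iic]; omega
    · have h1 := hB.le_inner_apply_self hn (k := k) (x := x) fun i hi =>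
        b.repr_eq_zero_of_mem_span hx (by simpa using hi)
      have h2 := mul_le_mul_of_nonneg_left h1 ht
      rw [key]
      linarith [(abs_le.1 (hP x)).1]
  · suffices hT.eigenvalues hn k ≤ t * hB.eigenvalues hn k + C by linarith
    refine hT.eigenvalues_le_of_forall_mem hn
      (Submodule.span ℝ (b '' (Finset.Ici k : Finset (Fin n)))) ?_ fun x hx => ?_
    · rw [b.finrank_span_image, Fin.card_Ici]; omega
    · have h1 := hB.inner_apply_self_le hn (k := k) (x := x) fun i hi =>
        b.repr_eq_zero_of_mem_span hx (by simpa using hi)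
      have h2 := mul_le_mul_of_nonneg_left h1 ht
      rw [key]
      linarith [(abs_le.1 (hP x)).2]

/-- A positive semidefinite operator is bounded below on the orthogonal complement of its
kernel. -/
theorem exists_pos_forall_mem_ker_orthogonal (hB : B.IsSymmetric) (hB0 : ∀ x, 0 ≤ ⟪B x, x⟫) :
    ∃ δ > 0, ∀ x ∈ (ker B)ᗮ, δ * ‖x‖ ^ 2 ≤ ⟪B x, x⟫ := by
  set b := hB.eigenvectorBasis rfl
  set l := hB.eigenvalues rfl
  have hl : ∀ i, 0 ≤ l i := fun i => by
    have := hB0 (b i)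
    rwa [hB.apply_eigenvectorBasis, real_inner_smul_left, real_inner_self_eq_norm_sq,
      b.orthonormal.1, one_pow, mul_one] at this
  -- Any small enough `δ` lies below all nonzero eigenvalues; the filter form also covers the case
  -- where there are none.
  have hev : ∀ᶠ δ : ℝ in 𝓝[>] 0, ∀ i, l i = 0 ∨ δ ≤ l i := by
    refine eventually_all.2 fun i => ?_
    rcases (hl i).eq_or_lt with h | h
    · exact Eventually.of_forall fun _ => Or.inl h.symm
    · filter_upwards [Ioo_mem_nhdsGT h] with δ hδ using Or.inr hδ.2.le
  obtain ⟨δ, hδ, hδ0⟩ := (hev.and self_mem_nhdsWithin).exists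
  refine ⟨δ, hδ0, fun x hx => ?_⟩
  rw [hB.inner_apply_self_eq_sum rfl, ← b.repr.norm_map x, EuclideanSpace.real_norm_sq_eq,
    Finset.mul_sum]
  refine Finset.sum_le_sum fun i _ => ?_
  rcases hδ i with h | h
  · have hbi : b i ∈ ker B := by
      rw [mem_ker, hB.apply_eigenvectorBasis]
      simp [show hB.eigenvalues rfl i = 0 from h]
    have : b.repr x i = 0 := by
      rw [OrthonormalBasis.repr_apply_apply]; exact hx _ hbi
    simp [this, b] at this ⊢
  · exact mul_le_mul_of_nonneg_right h (sq_nonneg _)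

end LinearMap.IsSymmetric

/-! ### Compressions and the spectrum of `P + t B` for large `t`. -/

namespace LinearMap

open Module

variable {E : Type*} [NormedAddCommGroup E] [InnerProductSpace ℝ E] [FiniteDimensional ℝ E]
  {T B P : E →ₗ[ℝ] E} {n c : ℕ}

local notation "⟪" x ", " y "⟫" => inner ℝ x y

/-- The compression of an operator to a subspace. -/
noncomputable def compression (P : E →ₗ[ℝ] E) (K : Submodule ℝ E) : K →ₗ[ℝ] K :=
  (K.orthogonalProjectionOnto : E →ₗ[ℝ] K) ∘ₗ P ∘ₗ K.subtype

theorem inner_compression_apply (P : E →ₗ[ℝ] E) (K : Submodule ℝ E) (x y : K) :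
    ⟪P.compression K x, y⟫ = ⟪P x, (y : E)⟫ := by
  simp [compression]

theorem IsSymmetric.compression (hP : P.IsSymmetric) (K : Submodule ℝ E) :
    (P.compression K).IsSymmetric := fun x y => by
  rw [inner_compression_apply, hP, real_inner_comm (P.compression K y) x, inner_compression_apply,
    real_inner_comm]

theorem abs_inner_apply_le (P : E →ₗ[ℝ] E) :
    ∃ C, 0 ≤ C ∧ ∀ x y, |⟪P x, y⟫| ≤ C * ‖x‖ * ‖y‖ := by
  refine ⟨‖P.toContinuousLinearMap‖, norm_nonneg _, fun x y => ?_⟩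
  refine (abs_real_inner_le_norm _ _).trans ?_
  gcongr
  exact P.toContinuousLinearMap.le_opNorm x

namespace IsSymmetric

/-- On `ker B` the forms of `T` and `P` agree, so eigenvectors of the compression serve as test
vectors. The bound is exact for every `t`, which later gives strict negativity without a limit. -/
theorem eigenvalues_le_eigenvalues_compression (hT : T.IsSymmetric) (hP : P.IsSymmetric)
    (hn : finrank ℝ E = n) (hc : finrank ℝ (ker B) = c) {t : ℝ} (hTB : T = P + t • B)
    {i : Fin n} {j : Fin c} (hij : (i : ℕ) = n - c + j) :
    hT.eigenvalues hn i ≤ (hP.compression (ker B)).eigenvalues hc j := by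
  set hM := hP.compression (ker B)
  set b := hM.eigenvectorBasis hc
  refine hT.eigenvalues_le_of_forall_mem hn
    ((Submodule.span ℝ (b '' (Finset.Ici j : Finset (Fin c)))).map (ker B).subtype) ?_ ?_
  · rw [Submodule.finrank_map_subtype_eq, b.finrank_span_image, Fin.card_Ici]; omega
  · rintro _ ⟨x, hx, rfl⟩
    have h1 := hM.inner_apply_self_le hc (k := j) (x := x) fun i hi =>
        b.repr_eq_zero_of_mem_span hx (by simpa using hi)
    rw [inner_compression_apply] at h1
    have hx0 : B x = 0 := x.2
    simpa [hTB, hx0] using h1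

theorem eventually_le_eigenvalues {T : ℝ → E →ₗ[ℝ] E} (hT : ∀ t, (T t).IsSymmetric)
    (hB : B.IsSymmetric) (hB0 : ∀ x, 0 ≤ ⟪B x, x⟫) (hP : P.IsSymmetric)
    (hn : finrank ℝ E = n) (hc : finrank ℝ (ker B) = c) (hTB : ∀ t, T t = P + t • B)
    {i : Fin n} {j : Fin c} (hij : (i : ℕ) = n - c + j) {ε : ℝ} (hε : 0 < ε) :
    ∀ᶠ t in atTop, (hP.compression (ker B)).eigenvalues hc j - ε ≤ (hT t).eigenvalues hn i := by
  set hM := hP.compression (ker B)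
  set b := hM.eigenvectorBasis hc
  set m := hM.eigenvalues hc j
  obtain ⟨δ, hδ, hδB⟩ := hB.exists_pos_forall_mem_ker_orthogonal hB0
  obtain ⟨C, hC, hCP⟩ := P.abs_inner_apply_le
  -- The coefficient of `‖y‖ ^ 2` that `t B` must supply: `C ^ 2 / ε` absorbs the cross term `2⟪P y,
  -- z⟫` at the price of `ε ‖z‖ ^ 2`, `C` absorbs `⟪P y, y⟫`, and `m - ε` is the target.
  set D := C ^ 2 / ε + C + m - ε
  filter_upwards [eventually_ge_atTop (D / δ), eventually_ge_atTop 0] with t ht ht0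
  rw [div_le_iff₀ hδ] at ht
  have hcn : c ≤ n := hc ▸ hn ▸ Submodule.finrank_le _
  set U := (Submodule.span ℝ (b '' (Finset.Ioi j : Finset (Fin c)))).map (ker B).subtype with hU
  have hUr : finrank ℝ U = c - 1 - j := by
    rw [Submodule.finrank_map_subtype_eq, b.finrank_span_image, Fin.card_Ioi]
  -- `Uᗮ` has dimension `n - (c - 1 - j) = i + 1`. Its vectors may leave `ker B`, but their
  -- projections `z` to `ker B` only involve eigenvectors of index at most `j`.
  refine (hT t).le_eigenvalues_of_forall_mem hn Uᗮ ?_ fun x hx => ?_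
  · have := U.finrank_add_finrank_orthogonal
    have := j.2
    omega
  · set z : ker B := (ker B).orthogonalProjectionOnto x with hz
    set y : E := x - z with hy
    have hyK : y ∈ (ker B)ᗮ := Submodule.sub_starProjection_mem_orthogonal (K := ker B) x
    have hyz : ⟪(z : E), y⟫ = 0 := hyK _ z.2
    have hx' : x = y + z := by simp [hy]
    have hz1 := hM.le_inner_apply_self hc (k := j) (x := z) fun k hk => by
      rw [OrthonormalBasis.repr_apply_apply, Submodule.coe_inner]
      have h1 : ⟪((b k : ker B) : E), x⟫ = 0 := hx _ (Submodule.mem_map.2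
        ⟨b k, Submodule.subset_span ⟨k, by simpa using hk, rfl⟩, rfl⟩)
      rw [hx', inner_add_right, hyK _ (b k).2, zero_add] at h1
      exact h1
    rw [inner_compression_apply, Submodule.coe_norm] at hz1
    have hBz : B z = 0 := z.2
    have e1 : ⟪T t x, x⟫ = t * ⟪B y, y⟫ + ⟪P y, y⟫ + 2 * ⟪P y, z⟫ + ⟪P z, z⟫ := by
      have h2 : ⟪B y, (z : E)⟫ = 0 := by rw [hB, hBz, inner_zero_right]
      have h3 : ⟪P z, y⟫ = ⟪P y, z⟫ := by rw [hP, real_inner_comm]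
      rw [hTB, hx']
      simp only [add_apply, smul_apply, map_add, hBz, inner_add_left, inner_add_right,
        real_inner_smul_left, h2, h3, add_zero, smul_zero]
      ring
    have e2 : ‖x‖ ^ 2 = ‖y‖ ^ 2 + ‖(z : E)‖ ^ 2 := by
      rw [hx', ← real_inner_self_eq_norm_sq, ← real_inner_self_eq_norm_sq,
        ← real_inner_self_eq_norm_sq]
      simp only [inner_add_left, inner_add_right, hyz, real_inner_comm (z : E) y]
      ring
    have h4 := mul_le_mul_of_nonneg_left (hδB y hyK) ht0
    have h5 := (abs_le.1 (hCP y y)).1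
    have h6 := (abs_le.1 (hCP y z)).1
    have h7 : D * ‖y‖ ^ 2 ≤ t * δ * ‖y‖ ^ 2 := mul_le_mul_of_nonneg_right ht (sq_nonneg _)
    have h8 : 0 ≤ C ^ 2 / ε * ‖y‖ ^ 2 - 2 * C * ‖y‖ * ‖(z : E)‖ + ε * ‖(z : E)‖ ^ 2 := by
      have : C ^ 2 / ε * ‖y‖ ^ 2 - 2 * C * ‖y‖ * ‖(z : E)‖ + ε * ‖(z : E)‖ ^ 2
        = (C * ‖y‖ - ε * ‖(z : E)‖) ^ 2 / ε := by field_simp; ring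
      rw [this]; positivity
    rw [e1, e2]
    have h9 : D * ‖y‖ ^ 2 = C ^ 2 / ε * ‖y‖ ^ 2 + C * ‖y‖ ^ 2 + (m - ε) * ‖y‖ ^ 2 := by
      simp only [D]; ring
    nlinarith

theorem tendsto_eigenvalues {T : ℝ → E →ₗ[ℝ] E} (hT : ∀ t, (T t).IsSymmetric)
    (hB : B.IsSymmetric) (hB0 : ∀ x, 0 ≤ ⟪B x, x⟫) (hP : P.IsSymmetric)
    (hn : finrank ℝ E = n) (hc : finrank ℝ (ker B) = c) (hTB : ∀ t, T t = P + t • B)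
    {i : Fin n} {j : Fin c} (hij : (i : ℕ) = n - c + j) :
    Tendsto (fun t => (hT t).eigenvalues hn i) atTop
      (𝓝 ((hP.compression (ker B)).eigenvalues hc j)) := by
  refine tendsto_order.2 ⟨fun a ha => ?_, fun a ha => Eventually.of_forall fun t =>
    ((hT t).eigenvalues_le_eigenvalues_compression hP hn hc (hTB t) hij).trans_lt ha⟩
  filter_upwards [eventually_le_eigenvalues hT hB hB0 hP hn hc hTB hij
    (half_pos (sub_pos.2 ha))] with t ht
  linarith

theorem eventually_eigenvalues_pos {T : ℝ → E →ₗ[ℝ] E} (hT : ∀ t, (T t).IsSymmetric)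
    (hB : B.IsSymmetric) (hB0 : ∀ x, 0 ≤ ⟪B x, x⟫)
    (hn : finrank ℝ E = n) (hc : finrank ℝ (ker B) = c) (hTB : ∀ t, T t = P + t • B) :
    ∀ᶠ t in atTop, ∀ i : Fin n, (i : ℕ) < n - c → 0 < (hT t).eigenvalues hn i := by
  obtain ⟨δ, hδ, hδB⟩ := hB.exists_pos_forall_mem_ker_orthogonal hB0
  obtain ⟨C, hC, hCP⟩ := P.abs_inner_apply_le
  filter_upwards [eventually_gt_atTop (C / δ), eventually_ge_atTop 0] with t ht ht0 i hi
  rw [div_lt_iff₀ hδ] at ht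
  -- On this space of dimension `n - c` the form is at least `(t δ - C) ‖x‖ ^ 2`.
  refine (sub_pos.2 ht).trans_le ((hT t).le_eigenvalues_of_forall_mem hn (ker B)ᗮ ?_ fun x hx => ?_)
  · have := (ker B).finrank_add_finrank_orthogonal
    omega
  · have h4 := mul_le_mul_of_nonneg_left (hδB x hx) ht0
    have h5 := (abs_le.1 (hCP x x)).1
    simp only [hTB, add_apply, smul_apply, inner_add_left, real_inner_smul_left]
    linarith

end IsSymmetric

end LinearMap

/-! ### Quadratic forms of signed Laplacians and the kernel of `L(Γ₋)`. -/

namespace WeightedGraph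

open Matrix

variable {V : Type*} (Γ : WeightedGraph V)

local notation "⟪" x ", " y "⟫" => inner ℝ x y

theorem eq_of_reachable (f : V → ℝ)
    (hf : ∀ i k, Γ.weight i k ≠ 0 → f i = f k) {i k : V} (h : Γ.graph.Reachable i k) :
    f i = f k := by
  obtain ⟨p⟩ := h
  induction p with
  | nil => rfl
  | cons h _ ih => exact (hf _ _ h).trans ih

theorem scaleNeg_zero_weight_nonneg (i k : V) : 0 ≤ (Γ.scaleNeg 0).weight i k := by
  simp only [scaleNeg]
  split_ifs with h
  · simp
  · exact not_lt.1 h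

theorem negComponent_surjective : Function.Surjective Γ.negComponent :=
  Quot.mk_surjective

theorem negComponent_eq_of_weight_neg {i k : V} (h : Γ.weight i k < 0) :
    Γ.negComponent i = Γ.negComponent k := by
  refine SimpleGraph.ConnectedComponent.sound (SimpleGraph.Adj.reachable ?_)
  simp [graph, negPart, h]

theorem scaleNeg_weight_of_negComponent_ne {i k : V} (t : ℝ)
    (h : Γ.negComponent i ≠ Γ.negComponent k) : (Γ.scaleNeg t).weight i k = Γ.weight i k :=
  if_neg fun h' => h (Γ.negComponent_eq_of_weight_neg h')

/-- Functions on the set of components of `Γ₋`, viewed as functions on the vertices. -/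
noncomputable def liftNeg : (Γ.NegComponent → ℝ) →ₗ[ℝ] EuclideanSpace ℝ V where
  toFun f := WithLp.toLp 2 (f ∘ Γ.negComponent)
  map_add' _ _ := rfl
  map_smul' _ _ := rfl

@[simp]
theorem liftNeg_apply (f : Γ.NegComponent → ℝ) (i : V) :
    Γ.liftNeg f i = f (Γ.negComponent i) := rfl

variable [Fintype V]

theorem inner_liftNeg_single (x : EuclideanSpace ℝ V) (a : Γ.NegComponent) :
    ⟪x, Γ.liftNeg (Pi.single a 1)⟫ = ∑ i with Γ.negComponent i = a, x i := by
  simp [PiLp.inner_apply, Pi.single_apply, Finset.sum_filter]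

/-- `S` is the Gram matrix of the component indicators. -/
theorem sizeMatrix_mulVec (f : Γ.NegComponent → ℝ) (a : Γ.NegComponent) :
    (Γ.sizeMatrix *ᵥ f) a = ⟪Γ.liftNeg f, Γ.liftNeg (Pi.single a 1)⟫ := by
  rw [inner_liftNeg_single, sizeMatrix, mulVec_diagonal, Finset.sum_congr rfl
    (g := fun _ => f a) (fun i hi => by simp [(Finset.mem_filter.1 hi).2])]
  simp [Nat.card_eq_fintype_card, Fintype.card_subtype]

variable [DecidableEq V]

/-- The signed Laplacian as an operator on Euclidean space. -/
noncomputable def laplacianLin : EuclideanSpace ℝ V →ₗ[ℝ] EuclideanSpace ℝ V :=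
  Matrix.toEuclideanLin Γ.laplacian

theorem laplacianLin_isSymmetric : Γ.laplacianLin.IsSymmetric :=
  isSymmetric_toEuclideanLin_iff.mpr Γ.laplacian_isHermitian

theorem laplacian_mulVec (x : V → ℝ) (i : V) :
    (Γ.laplacian *ᵥ x) i = ∑ k, Γ.weight i k * (x k - x i) := by
  have h : ∀ k ∈ Finset.univ.erase i, Γ.laplacian i k * x k = Γ.weight i k * x k := fun k hk => by
    rw [laplacian, of_apply, if_neg (Finset.ne_of_mem_erase hk).symm]
  simp only [mulVec, dotProduct]
  rw [← Finset.add_sum_erase _ _ (Finset.mem_univ i), ← Finset.add_sum_erase (a := i) _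
    (fun k => Γ.weight i k * (x k - x i)) (Finset.mem_univ i), Finset.sum_congr rfl h]
  simp only [laplacian, of_apply, if_true, sub_self, mul_zero, zero_add, mul_sub,
    Finset.sum_sub_distrib, ← Finset.sum_mul]
  ring

theorem laplacianLin_apply (x : EuclideanSpace ℝ V) (i : V) :
    Γ.laplacianLin x i = ∑ k, Γ.weight i k * (x k - x i) := by
  rw [← laplacian_mulVec]; rfl

/-- Summation by parts: average the double sum with its copy under exchange of `i` and `k`. The sign
of the form is thus opposite to that of the weights. -/
theorem inner_laplacianLin (x : EuclideanSpace ℝ V) :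
    ⟪Γ.laplacianLin x, x⟫ = -(∑ i, ∑ k, Γ.weight i k * (x k - x i) ^ 2) / 2 := by
  have h1 : ⟪Γ.laplacianLin x, x⟫ = ∑ i, ∑ k, Γ.weight i k * (x k - x i) * x i := by
    simp [PiLp.inner_apply, laplacianLin_apply, Finset.mul_sum, mul_comm]
  have h2 : ⟪Γ.laplacianLin x, x⟫ = ∑ i, ∑ k, Γ.weight i k * (x i - x k) * x k := by
    rw [h1, Finset.sum_comm]
    simp only [Γ.symm]
  have h3 : ∑ i, ∑ k, Γ.weight i k * (x k - x i) ^ 2 =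
      -(∑ i, ∑ k, Γ.weight i k * (x k - x i) * x i) -
        ∑ i, ∑ k, Γ.weight i k * (x i - x k) * x k := by
    simp only [← Finset.sum_neg_distrib, ← Finset.sum_sub_distrib]
    exact Finset.sum_congr rfl fun i _ => Finset.sum_congr rfl fun k _ => by ring
  rw [h3, ← h1, ← h2]
  ring

/-- When all weights have one sign, a vanishing form kills every summand. The factor `s` records the
sign, so that `Γ₋` (`s = -1`) and `Γ₊` (`s = 1`) are treated together. -/
theorem eq_of_inner_laplacianLin_eq_zero {x : EuclideanSpace ℝ V} {s : ℝ}
    (hs : ∀ i k, 0 ≤ s * Γ.weight i k) (hs0 : s ≠ 0) (hx : ⟪Γ.laplacianLin x, x⟫ = 0)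
    {i k : V} (hik : Γ.weight i k ≠ 0) : x i = x k := by
  rw [inner_laplacianLin] at hx
  have h0 : ∑ i, ∑ k, s * Γ.weight i k * (x k - x i) ^ 2 = 0 := by
    simp only [mul_assoc, ← Finset.mul_sum]
    rw [show ∑ i, ∑ k, Γ.weight i k * (x k - x i) ^ 2 = 0 by linarith, mul_zero]
  have hnn : ∀ i k, 0 ≤ s * Γ.weight i k * (x k - x i) ^ 2 := fun i k =>
    mul_nonneg (hs i k) (sq_nonneg _)
  have h1 := (Finset.sum_eq_zero_iff_of_nonneg fun i _ =>
    Finset.sum_nonneg fun k _ => hnn i k).1 h0 i (Finset.mem_univ i)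
  have h2 := (Finset.sum_eq_zero_iff_of_nonneg fun k _ => hnn i k).1 h1 k (Finset.mem_univ k)
  have h3 : x k - x i = 0 := by simpa [hs0, hik] using h2
  linarith

theorem inner_laplacianLin_negPart_nonneg (x : EuclideanSpace ℝ V) :
    0 ≤ ⟪Γ.negPart.laplacianLin x, x⟫ := by
  rw [inner_laplacianLin]
  have : ∑ i, ∑ k, Γ.negPart.weight i k * (x k - x i) ^ 2 ≤ 0 :=
    Finset.sum_nonpos fun i _ => Finset.sum_nonpos fun k _ =>
      mul_nonpos_of_nonpos_of_nonneg (min_le_right _ _) (sq_nonneg _)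
  linarith

theorem inner_laplacianLin_scaleNeg_zero_nonpos (x : EuclideanSpace ℝ V) :
    ⟪(Γ.scaleNeg 0).laplacianLin x, x⟫ ≤ 0 := by
  rw [inner_laplacianLin]
  have : 0 ≤ ∑ i, ∑ k, (Γ.scaleNeg 0).weight i k * (x k - x i) ^ 2 :=
    Finset.sum_nonneg fun i _ => Finset.sum_nonneg fun k _ =>
      mul_nonneg (Γ.scaleNeg_zero_weight_nonneg i k) (sq_nonneg _)
  linarith

theorem laplacianLin_scaleNeg (t : ℝ) :
    (Γ.scaleNeg t).laplacianLin = (Γ.scaleNeg 0).laplacianLin + t • Γ.negPart.laplacianLin := by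
  ext x i
  simp only [LinearMap.add_apply, LinearMap.smul_apply, PiLp.add_apply, PiLp.smul_apply,
    laplacianLin_apply, smul_eq_mul, Finset.mul_sum, ← Finset.sum_add_distrib]
  refine Finset.sum_congr rfl fun k _ => ?_
  simp only [scaleNeg, negPart]
  split_ifs with h
  · rw [min_eq_left h.le]; ring
  · rw [min_eq_right (not_lt.1 h)]; ring

theorem mem_ker_laplacianLin_negPart {x : EuclideanSpace ℝ V} :
    x ∈ LinearMap.ker Γ.negPart.laplacianLin ↔
      ∀ i k, Γ.negComponent i = Γ.negComponent k → x i = x k := by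
  constructor
  · intro hx i k hik
    refine Γ.negPart.eq_of_reachable x (fun i k h => ?_) (SimpleGraph.ConnectedComponent.exact hik)
    refine Γ.negPart.eq_of_inner_laplacianLin_eq_zero (s := -1) (fun i k => ?_) (by norm_num) ?_ h
    · have : Γ.negPart.weight i k ≤ 0 := min_le_right _ _
      linarith
    · rw [LinearMap.mem_ker.1 hx, inner_zero_left]
  · intro hx
    rw [LinearMap.mem_ker]
    ext i
    rw [laplacianLin_apply]
    refine Finset.sum_eq_zero fun k _ => ?_
    by_cases h : Γ.weight i k < 0
    · rw [hx i k (Γ.negComponent_eq_of_weight_neg h)]; simp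
    · simp [negPart, min_eq_right (not_lt.1 h)]

/-! ### The compression as the generalized problem on the contracted graph. -/

theorem liftNeg_mem_ker (f : Γ.NegComponent → ℝ) :
    Γ.liftNeg f ∈ LinearMap.ker Γ.negPart.laplacianLin :=
  Γ.mem_ker_laplacianLin_negPart.2 fun i k h => by simp [h]

/-- The kernel of the Laplacian of `Γ₋` consists of the functions that are constant on
components. -/
noncomputable def kerNegEquiv :
    (Γ.NegComponent → ℝ) ≃ₗ[ℝ] LinearMap.ker Γ.negPart.laplacianLin :=
  LinearEquiv.ofBijective (Γ.liftNeg.codRestrict _ Γ.liftNeg_mem_ker) <| by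
    constructor
    · intro f g h
      funext a
      obtain ⟨i, rfl⟩ := Γ.negComponent_surjective a
      exact congrFun (congrArg WithLp.ofLp (congrArg Subtype.val h)) i
    · rintro ⟨x, hx⟩
      refine ⟨fun a => x (Function.surjInv Γ.negComponent_surjective a), ?_⟩
      ext i
      exact Γ.mem_ker_laplacianLin_negPart.1 hx _ _
        (Function.surjInv_eq Γ.negComponent_surjective _)

theorem finrank_ker_laplacianLin_negPart :
    Module.finrank ℝ (LinearMap.ker Γ.negPart.laplacianLin) = Fintype.card Γ.NegComponent := by
  rw [← Γ.kerNegEquiv.finrank_eq, Module.finrank_fintype_fun_eq_card]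

/-- Group the sum over vertices by component: lifted functions have no differences inside a
component, and between distinct components no edge is negative, so `Γ₊` and `Γ` have the same
weights there. -/
theorem laplacian_contractNeg_mulVec (f : Γ.NegComponent → ℝ) (a : Γ.NegComponent) :
    (Γ.contractNeg.laplacian *ᵥ f) a =
      ⟪(Γ.scaleNeg 0).laplacianLin (Γ.liftNeg f), Γ.liftNeg (Pi.single a 1)⟫ := by
  rw [laplacian_mulVec, inner_liftNeg_single]
  simp only [laplacianLin_apply, liftNeg_apply]
  rw [Finset.sum_congr rfl fun i _ => (Finset.sum_fiberwise Finset.univ Γ.negComponent _).symm,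
    Finset.sum_comm]
  refine Finset.sum_congr rfl fun d _ => ?_
  by_cases h : a = d
  · subst h
    rw [sub_self, mul_zero]
    refine (Finset.sum_eq_zero fun i hi => Finset.sum_eq_zero fun k hk => ?_).symm
    rw [(Finset.mem_filter.1 hi).2, (Finset.mem_filter.1 hk).2, sub_self, mul_zero]
  · simp only [contractNeg, if_neg h, Finset.sum_mul]
    refine Finset.sum_congr rfl fun i hi => Finset.sum_congr rfl fun k hk => ?_
    have hi := (Finset.mem_filter.1 hi).2
    have hk := (Finset.mem_filter.1 hk).2
    rw [Γ.scaleNeg_weight_of_negComponent_ne 0 (by rwa [hi, hk]), hi, hk]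

/-- The eigenvalues of the compression of `L(Γ₊)` to the kernel of `L(Γ₋)`. -/
noncomputable def contractedEigenvalue : Fin (Fintype.card Γ.NegComponent) → ℝ :=
  ((Γ.scaleNeg 0).laplacianLin_isSymmetric.compression
    (LinearMap.ker Γ.negPart.laplacianLin)).eigenvalues Γ.finrank_ker_laplacianLin_negPart

/-- Pairing the eigenvector equation of the compression with the indicator of each component turns
its two sides into the contracted Laplacian and `S`. -/
theorem isGenEigenvalueList_contractedEigenvalue :
    IsGenEigenvalueList Γ.contractNeg.laplacian Γ.sizeMatrix Γ.contractedEigenvalue := by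
  set hM := (Γ.scaleNeg 0).laplacianLin_isSymmetric.compression
    (LinearMap.ker Γ.negPart.laplacianLin)
  refine ⟨hM.eigenvalues_antitone _,
    (hM.eigenvectorBasis Γ.finrank_ker_laplacianLin_negPart).toBasis.map Γ.kerNegEquiv.symm,
    fun j => ?_⟩
  set w := hM.eigenvectorBasis Γ.finrank_ker_laplacianLin_negPart j with hw
  have hlift : Γ.liftNeg (Γ.kerNegEquiv.symm w) = w :=
    congrArg Subtype.val (Γ.kerNegEquiv.apply_symm_apply w)
  funext a
  rw [Module.Basis.map_apply, OrthonormalBasis.coe_toBasis, Pi.smul_apply,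
    laplacian_contractNeg_mulVec, sizeMatrix_mulVec, ← hw, hlift]
  have h := LinearMap.inner_compression_apply (Γ.scaleNeg 0).laplacianLin _ w
    ⟨_, Γ.liftNeg_mem_ker (Pi.single a 1)⟩
  rw [← h, hw, hM.apply_eigenvectorBasis, real_inner_smul_left]
  rfl

/-! ### Signs of the limiting eigenvalues. -/

variable {Γ}

theorem eq_of_inner_laplacianLin_scaleNeg_zero_eq_zero (hΓ : Γ.graph.Connected)
    {x : EuclideanSpace ℝ V} (hx : x ∈ LinearMap.ker Γ.negPart.laplacianLin)
    (hx0 : ⟪(Γ.scaleNeg 0).laplacianLin x, x⟫ = 0) (i k : V) : x i = x k := by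
  refine Γ.eq_of_reachable x (fun i k h => ?_) (hΓ.preconnected i k)
  rcases h.lt_or_gt with h | h
  · exact Γ.mem_ker_laplacianLin_negPart.1 hx i k (Γ.negComponent_eq_of_weight_neg h)
  · refine (Γ.scaleNeg 0).eq_of_inner_laplacianLin_eq_zero (s := 1)
      (fun i k => by simpa using Γ.scaleNeg_zero_weight_nonneg i k) one_ne_zero hx0 ?_
    simp [scaleNeg, h.not_gt, h.ne']

theorem contractedEigenvalue_nonpos (j : Fin (Fintype.card Γ.NegComponent)) :
    Γ.contractedEigenvalue j ≤ 0 :=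
  LinearMap.IsSymmetric.eigenvalues_le_of_forall_mem _ _ ⊤
    (by rw [finrank_top, finrank_ker_laplacianLin_negPart]; omega) fun x _ => by
      rw [LinearMap.inner_compression_apply, zero_mul]
      exact Γ.inner_laplacianLin_scaleNeg_zero_nonpos _

/-- A zero eigenvalue at `j > 0` forces one at index `0` too. By connectedness both eigenvectors are
nonzero constants, which cannot be orthogonal. -/
theorem contractedEigenvalue_neg (hΓ : Γ.graph.Connected)
    {j : Fin (Fintype.card Γ.NegComponent)} (hj : 0 < (j : ℕ)) :
    Γ.contractedEigenvalue j < 0 := by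
  refine (contractedEigenvalue_nonpos j).lt_of_ne fun h0 => ?_
  set hM := (Γ.scaleNeg 0).laplacianLin_isSymmetric.compression
    (LinearMap.ker Γ.negPart.laplacianLin)
  set b := hM.eigenvectorBasis Γ.finrank_ker_laplacianLin_negPart with hb
  set o : Fin (Fintype.card Γ.NegComponent) := ⟨0, hj.trans j.2⟩
  have ho : Γ.contractedEigenvalue o = 0 :=
    le_antisymm (contractedEigenvalue_nonpos o)
      (h0 ▸ hM.eigenvalues_antitone _ (show o ≤ j from Nat.zero_le _))
  have hconst : ∀ l, Γ.contractedEigenvalue l = 0 → ∀ i k, (b l : EuclideanSpace ℝ V) i =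
      (b l : EuclideanSpace ℝ V) k := fun l hl =>
    eq_of_inner_laplacianLin_scaleNeg_zero_eq_zero hΓ (b l).2 <| by
      rw [← LinearMap.inner_compression_apply, hb, hM.apply_eigenvectorBasis]
      simp [show hM.eigenvalues Γ.finrank_ker_laplacianLin_negPart l = 0 from hl]
  obtain ⟨v⟩ := hΓ.nonempty
  have hne : ∀ l, Γ.contractedEigenvalue l = 0 → (b l : EuclideanSpace ℝ V) v ≠ 0 := by
    intro l hl hv
    refine b.orthonormal.ne_zero l (Subtype.ext ?_)
    ext i
    rw [hconst l hl i v, hv]; rfl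
  have horth : ⟪b o, b j⟫ = 0 := b.orthonormal.2 (Fin.ne_of_val_ne hj.ne)
  rw [Submodule.coe_inner, PiLp.inner_apply, Finset.sum_congr rfl fun i _ => by
    rw [hconst o ho i v, hconst j h0 i v]] at horth
  have := hne o ho
  have := hne j h0
  have : Nonempty V := ⟨v⟩
  simp_all

theorem exists_eigenvalue_eq_zero [Nonempty V] (Γ : WeightedGraph V) :
    ∃ i, Γ.eigenvalue i = 0 := by
  refine Γ.laplacianLin_isSymmetric.exists_eigenvalues_eq finrank_euclideanSpace (μ := 0) ?_
  refine Module.End.hasEigenvalue_of_hasEigenvector (x := WithLp.toLp 2 fun _ => 1)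
    ⟨?_, fun h => ?_⟩
  · rw [Module.End.mem_eigenspace_iff, zero_smul]
    ext i
    simp [laplacianLin_apply]
  · simpa using congrFun (congrArg WithLp.ofLp h) (Classical.arbitrary V)

end WeightedGraph

theorem mainTheorem10 {V : Type*} [Fintype V] [DecidableEq V] (Γ : WeightedGraph V)
    (hΓ : Γ.graph.Connected) :
    (∀ᶠ t : ℝ in atTop,
      (Γ.scaleNeg t).nPos = Fintype.card V - Fintype.card Γ.NegComponent ∧
      (Γ.scaleNeg t).nNeg = Fintype.card Γ.NegComponent - 1 ∧
      (Γ.scaleNeg t).nZero = 1) ∧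
    (∀ i : Fin (Fintype.card V), (i : ℕ) < Fintype.card V - Fintype.card Γ.NegComponent →
      (fun t : ℝ => (Γ.scaleNeg t).eigenvalue i - t * Γ.negPart.eigenvalue i)
        =O[atTop] fun _ => (1 : ℝ)) ∧
    ∃ μ : Fin (Fintype.card Γ.NegComponent) → ℝ,
      IsGenEigenvalueList Γ.contractNeg.laplacian Γ.sizeMatrix μ ∧
      ∀ (i : Fin (Fintype.card V)) (j : Fin (Fintype.card Γ.NegComponent)),
        (i : ℕ) = Fintype.card V - Fintype.card Γ.NegComponent + j →
        Tendsto (fun t : ℝ => (Γ.scaleNeg t).eigenvalue i) atTop (𝓝 (μ j)) := by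
  have hT := fun t => (Γ.scaleNeg t).laplacianLin_isSymmetric
  have hB := Γ.negPart.laplacianLin_isSymmetric
  have hB0 := Γ.inner_laplacianLin_negPart_nonneg
  have hn : Module.finrank ℝ (EuclideanSpace ℝ V) = Fintype.card V := finrank_euclideanSpace
  have hc := Γ.finrank_ker_laplacianLin_negPart
  have hTB := Γ.laplacianLin_scaleNeg
  refine ⟨?_, fun i _ => ?_, Γ.contractedEigenvalue, Γ.isGenEigenvalueList_contractedEigenvalue,
    fun i j hij => LinearMap.IsSymmetric.tendsto_eigenvalues hT hB hB0 (hT 0) hn hc hTB hij⟩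
  · have hV : Nonempty V := hΓ.nonempty
    have hcn : Fintype.card Γ.NegComponent ≤ Fintype.card V :=
      Fintype.card_le_of_surjective _ Γ.negComponent_surjective
    have hc0 : 0 < Fintype.card Γ.NegComponent :=
      Fintype.card_pos_iff.2 (hV.map Γ.negComponent)
    filter_upwards [LinearMap.IsSymmetric.eventually_eigenvalues_pos hT hB hB0 hn hc hTB]
      with t hpos
    replace hpos : ∀ i : Fin (Fintype.card V),
      (i : ℕ) < Fintype.card V - Fintype.card Γ.NegComponent → 0 < (Γ.scaleNeg t).eigenvalue i :=
        hpos
    have hneg : ∀ i : Fin (Fintype.card V),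
        Fintype.card V - Fintype.card Γ.NegComponent < i → (Γ.scaleNeg t).eigenvalue i < 0 := by
      intro i hi
      have h := (hT t).eigenvalues_le_eigenvalues_compression (hT 0) hn hc (hTB t) (i := i)
        (j := ⟨i - (Fintype.card V - Fintype.card Γ.NegComponent), by omega⟩) (by simp; omega)
      exact h.trans_lt (WeightedGraph.contractedEigenvalue_neg hΓ (by simpa using hi))
    have hzero : ∀ i : Fin (Fintype.card V),
        (i : ℕ) = Fintype.card V - Fintype.card Γ.NegComponent →
          (Γ.scaleNeg t).eigenvalue i = 0 := by
      intro i hi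
      -- Some eigenvalue vanishes because constants are in the kernel; the strict signs on either
      -- side leave only the index `N - c`.
      obtain ⟨k, hk⟩ := (Γ.scaleNeg t).exists_eigenvalue_eq_zero
      rcases lt_trichotomy (k : ℕ) (Fintype.card V - Fintype.card Γ.NegComponent) with h | h | h
      · exact absurd hk (hpos k h).ne'
      · rwa [Fin.ext (hi.trans h.symm)]
      · exact absurd hk (hneg k h).ne
    set m : Fin (Fintype.card V) := ⟨Fintype.card V - Fintype.card Γ.NegComponent, by omega⟩
    have hposm : ∀ i, 0 < (Γ.scaleNeg t).eigenvalue i ↔ i ∈ Finset.Iio m := fun i => by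
      rw [Finset.mem_Iio]
      refine ⟨fun h => ?_, fun h => hpos i h⟩
      by_contra! hmi
      rcases hmi.eq_or_lt with h' | h'
      · exact h.ne' (hzero i (congrArg Fin.val h'.symm))
      · exact h.not_gt (hneg i h')
    have hnegm : ∀ i, (Γ.scaleNeg t).eigenvalue i < 0 ↔ i ∈ Finset.Ioi m := fun i => by
      rw [Finset.mem_Ioi]
      refine ⟨fun h => ?_, fun h => hneg i h⟩
      by_contra! hmi
      rcases hmi.eq_or_lt with h' | h'
      · exact h.ne (hzero i (congrArg Fin.val h'))
      · exact h.not_gt (hpos i h')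
    have hzerom : ∀ i, (Γ.scaleNeg t).eigenvalue i = 0 ↔ i ∈ ({m} : Finset _) := fun i => by
      rw [Finset.mem_singleton]
      refine ⟨fun h => ?_, fun h => hzero i (congrArg Fin.val h)⟩
      rcases lt_trichotomy i m with h' | h' | h'
      · exact absurd h (hpos i h').ne'
      · exact h'
      · exact absurd h (hneg i h').ne
    simp only [WeightedGraph.nPos, WeightedGraph.nNeg, WeightedGraph.nZero, hposm, hnegm, hzerom,
      Nat.card_eq_fintype_card, Fintype.card_coe, Fin.card_Iio, Fin.card_Ioi,
      Finset.card_singleton, and_true, m, true_and]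
    omega
  · obtain ⟨C, -, hC⟩ := (Γ.scaleNeg 0).laplacianLin.abs_inner_apply_le
    refine IsBigO.of_bound C ?_
    filter_upwards [eventually_ge_atTop 0] with t ht
    rw [norm_one, mul_one, Real.norm_eq_abs]
    exact (hT t).abs_eigenvalues_sub_le hB hn ht (hTB t)
      (fun x => (hC x x).trans_eq (by ring)) i
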